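/- There are an absolute constant $c>0$ and, for every $n$, a partition matroid $\mathcal M_n$ on the ground set $[n]=\{1,\dots,n\}$ (given by a partition of $[n]$ into parts $P_1,\dots,P_m$ and integer capacities $u_1,\dots,u_m\ge 0$, a set $S$ being independent iff $|S\cap P_i|\le u_i$ for all $i$), such that the following holds. Let $\alpha>0$ and $C\in\mathbb N$ be constants. Then for all sufficiently large $n$ (depending on $\alpha$ and $C$) and for every randomized algorithm that accesses a matroid on $[n]$ only through an independence oracle (given $S\subseteq[n]$, the oracle answers whether $S$ is independent), makes at most $$\frac{n^{1/3}}{4\alpha\log^2 n}-1$$ sequential steps, each consisting of at most $n^{C}$ parallel queries that may depend on the answers obtained in earlier steps but not on each other's answers, and then outputs a set $S$ (with no restriction on computation between queries): 1. If the algorithm is run on $\mathcal M_n$ with its ground set relabelled by a hidden, uniformly random permutation of $[n]$ (equivalently, the partition into parts is uniformly random among all ordered partitions with the same part sizes), then with probability at most $n^{-c\log n}$, over the permutation and the random bits of the algorithm, the output $S$ is an $\alpha$-approximation for maximizing the cardinality function $f(S)=|S|$ over independent sets, i.e. $S$ is independent and $|T|\le\alpha|S|$ for every independent set $T$. 2.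 In particular, there is a fixed partition matroid on $[n]$ (a relabelling of $\mathcal M_n$) on which the algorithm outputs an $\alpha$-approximation with probability at most $n^{-c\log n}$ over its random bits. Here $\log$ is the natural logarithm. -/

import Mathlib

/-- The partition matroid on the ground set `Fin n` in which element `a` lies in the part
`part a`, and a set is independent iff it has at most `cap i` elements in each part `i`. -/
def partitionMatroid {n m : ℕ} (part : Fin n → Fin m) (cap : Fin m → ℕ) : Matroid (Fin n) :=
  (IndepMatroid.ofFinset Set.univ
    (fun S : Finset (Fin n) => ∀ i, (S.filter (fun a => part a = i)).card ≤ cap i)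
    (by simp)
    (fun I J hJ hIJ i => (Finset.card_le_card (Finset.filter_subset_filter _ hIJ)).trans (hJ i))
    (by
      intro I J hI hJ hlt
      have hcard : ∀ S : Finset (Fin n),
          S.card = ∑ i : Fin m, (S.filter (fun a => part a = i)).card := fun S =>
        Finset.card_eq_sum_card_fiberwise (fun a _ => Finset.mem_coe.2 (Finset.mem_univ _))
      obtain ⟨i, hi⟩ : ∃ i, (I.filter (fun a => part a = i)).card <
          (J.filter (fun a => part a = i)).card := by
        by_contra! hcon
        have := Finset.sum_le_sum (s := Finset.univ) (fun i _ => hcon i)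
        rw [← hcard, ← hcard] at this
        omega
      obtain ⟨e, heJ, heI⟩ := Finset.exists_mem_notMem_of_card_lt_card hi
      rw [Finset.mem_filter] at heJ heI
      refine ⟨e, heJ.1, fun h => heI ⟨h, heJ.2⟩, fun j => ?_⟩
      rw [Finset.filter_insert]
      split_ifs with hj
      · have hij : i = j := heJ.2.symm.trans hj
        subst hij
        exact (Finset.card_insert_le _ _).trans (hi.trans_le (hJ i))
      · exact hI j)
    (fun _ _ => Set.subset_univ _)).matroid

theorem partitionMatroid_indep_iff {n m : ℕ} (part : Fin n → Fin m) (cap : Fin m → ℕ)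
    (S : Finset (Fin n)) :
    (partitionMatroid part cap).Indep (S : Set (Fin n)) ↔
      ∀ i, (S.filter (fun a => part a = i)).card ≤ cap i := by
  simp [partitionMatroid]

/-- The independence oracle of a matroid: it answers whether the queried set is independent. -/
noncomputable def indepOracle {n : ℕ} (M : Matroid (Fin n)) : Finset (Fin n) → Bool :=
  open Classical in fun S => decide (M.Indep (S : Set (Fin n)))

/-- A deterministic algorithm on the ground set `Fin n` that makes `r` sequential steps of `q`
parallel queries to an oracle and then outputs a set. The queries of step `i` may depend, in an
arbitrary way, on the answers received in the steps before `i`, but not on the answers to other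
queries of step `i`. Queries may be repeated and answers ignored, so that algorithms making at most
`r` steps of at most `q` queries are covered. No bound is put on the computation between
queries. -/
structure QueryAlgorithm (n r q : ℕ) where
  query : (i : Fin r) → (Fin i → Fin q → Bool) → Fin q → Finset (Fin n)
  output : (Fin r → Fin q → Bool) → Finset (Fin n)

namespace QueryAlgorithm

variable {n r q : ℕ}

/-- The answers that the algorithm receives in its first `i` steps when it is run with the
oracle `O`. -/
def answers (D : QueryAlgorithm n r q) (O : Finset (Fin n) → Bool) :
    (i : ℕ) → i ≤ r → Fin i → Fin q → Bool
  | 0, _ => fun j => j.elim0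
  | i + 1, h =>
      Fin.snoc (α := fun _ => Fin q → Bool) (answers D O i (Nat.le_of_succ_le h))
        (fun k => O (D.query ⟨i, h⟩ (answers D O i (Nat.le_of_succ_le h)) k))

/-- The set returned by the algorithm when it is run with the oracle `O`. -/
def run (D : QueryAlgorithm n r q) (O : Finset (Fin n) → Bool) : Finset (Fin n) :=
  D.output (D.answers O r le_rfl)

end QueryAlgorithm

/-- `S` is an `α`-approximate solution of the problem of maximizing `f` over the independent sets
of `M`: it is feasible, and `f T ≤ α * f S` for every feasible `T`, that is, `OPT ≤ α * f S`. -/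
def IsApproxSolution {n : ℕ} (M : Matroid (Fin n)) (f : Finset (Fin n) → ℝ) (α : ℝ)
    (S : Finset (Fin n)) : Prop :=
  M.Indep (S : Set (Fin n)) ∧
    ∀ T : Finset (Fin n), M.Indep (T : Set (Fin n)) → f T ≤ α * f S

/-- A randomized algorithm is a probability distribution over deterministic ones. As there are only
finitely many deterministic algorithms for given `n`, `r`, `q`, every source of random
bits, used at any time during the run, gives such a distribution. -/
abbrev RandomizedAlgorithm (n r q : ℕ) := PMF (QueryAlgorithm n r q)

/-- The probability, over the random bits of the algorithm `A`, that `A` with access to the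
independence oracle of `M` returns an `α`-approximate solution of the problem of maximizing the
cardinality function `S ↦ |S|` over the independent sets of `M`. -/
noncomputable def RandomizedAlgorithm.successProb {n r q : ℕ} (A : RandomizedAlgorithm n r q)
    (M : Matroid (Fin n)) (α : ℝ) : ℝ :=
  (A.toOuterMeasure
    {D | IsApproxSolution M (fun S => (S.card : ℝ)) α (D.run (indepOracle M))}).toReal

/-- The probability of success of `A`, over its random bits and an independent uniformly random
permutation `σ` of the ground set, on the partition matroid that is hidden by relabelling its
ground set by `σ`. The parts `(part ∘ σ)⁻¹ (i)` form a uniformly random ordered partition of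
`Fin n` among those whose parts have the same sizes as the parts of `part`. -/
noncomputable def RandomizedAlgorithm.hiddenSuccessProb {n r q m : ℕ}
    (A : RandomizedAlgorithm n r q) (part : Fin n → Fin m) (cap : Fin m → ℕ) (α : ℝ) : ℝ :=
  (∑ σ : Equiv.Perm (Fin n), A.successProb (partitionMatroid (part ∘ σ) cap) α) /
    (Nat.factorial n : ℝ)

/-!
The hidden matroid has parts of equal size whose capacities `g, 2g, …, mg` form a staircase. A
query tells part `i` apart from the later parts only if it has at most `i * g` elements in part
`i` and at least `(i + 1) * g` in some later part; otherwise an oracle that checks only the parts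
up to `i` gives the true answer. Answering step `t` by the oracle that checks only the parts up to
`t + 1` therefore reproduces the true run unless some query, or the output, is unbalanced in this
way.

A set chosen without regard to how the elements of parts `i` and `j` are exchanged is unbalanced
with exponentially small probability: pair the elements of the two parts, and let `d k`, which is
`-1`, `0` or `1`, compare the two members of the pair `k`. Exchanging the members of one pair
flips the sign of one `d k` and keeps the others, so `∏ (1 + x * d k)` has mean `1`, while it is
at least `(1 + x) ^ g * (1 - x ^ 2) ^ (i * g)` on unbalanced sets; Markov's inequality with
`x = 1 / (2 * m)` gives the bound `exp (-g / (16 * m))`. After the union bound over all queries,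
the run with high probability ends without having seen the parts beyond `r + 1`, and its output
has at most `m * (r + 2) * g` elements, whereas the largest independent sets have at least
`m * (m + 1) * g / 2`.
-/

open Finset

section Exchange

variable {Ω ι : Type*} [Fintype Ω]

theorem card_filter_exists_le {κ : Type*} (s : Finset κ) (p : κ → Ω → Prop)
    [∀ k, DecidablePred (p k)] [DecidablePred fun ω => ∃ k ∈ s, p k ω] {c : ℝ}
    (hc : ∀ k ∈ s, (#{ω | p k ω} : ℝ) ≤ c) : (#{ω | ∃ k ∈ s, p k ω} : ℝ) ≤ #s * c := by
  classical
  have hunion : ({ω | ∃ k ∈ s, p k ω} : Finset Ω) = s.biUnion fun k => {ω | p k ω} := by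
    ext ω
    simp only [mem_filter_univ, mem_biUnion]
  calc (#{ω | ∃ k ∈ s, p k ω} : ℝ) ≤ ∑ k ∈ s, (#{ω | p k ω} : ℝ) := by
        rw [hunion]
        exact_mod_cast card_biUnion_le
    _ ≤ #s * c := by
        rw [← nsmul_eq_mul]
        exact sum_le_card_nsmul _ _ _ hc

theorem sum_prod_one_add_eq_card {R : Type*} [CommRing R] [NoZeroDivisors R] [CharZero R]
    {τ : ι → Equiv.Perm Ω} {d : ι → Ω → R} (hneg : ∀ k ω, d k (τ k ω) = -d k ω)
    (hfix : ∀ k l, l ≠ k → ∀ ω, d l (τ k ω) = d l ω) (K : Finset ι) :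
    ∑ ω, ∏ k ∈ K, (1 + d k ω) = (Fintype.card Ω : R) := by
  classical
  induction K using Finset.induction_on with
  | empty => simp
  | insert k K hk ih =>
    have hodd : ∑ ω, d k ω * ∏ l ∈ K, (1 + d l ω) = 0 := by
      have hcomp := Equiv.sum_comp (τ k) fun ω => d k ω * ∏ l ∈ K, (1 + d l ω)
      have hprod (ω : Ω) : ∏ l ∈ K, (1 + d l (τ k ω)) = ∏ l ∈ K, (1 + d l ω) :=
        prod_congr rfl fun l hl => by rw [hfix k l (ne_of_mem_of_not_mem hl hk)]
      simp only [hneg, hprod, neg_mul, sum_neg_distrib] at hcomp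
      exact neg_eq_self.1 hcomp
    simp only [prod_insert hk, one_add_mul, sum_add_distrib, ih, hodd, add_zero]

theorem one_add_pow_card_mul_one_sub_pow_card_le_prod [Fintype ι] [DecidableEq ι] {x : ℝ}
    (hx0 : 0 ≤ x) (hx1 : x ≤ 1) (A B : Finset ι) :
    (1 + x) ^ #B * (1 - x) ^ #A ≤
      ∏ k, (1 + x * ((if k ∈ B then 1 else 0) - (if k ∈ A then 1 else 0))) := by
  have hpow (y : ℝ) (s : Finset ι) : y ^ #s = ∏ k, if k ∈ s then y else 1 := by
    rw [prod_ite_mem, univ_inter, prod_const]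
  rw [hpow, hpow, ← prod_mul_distrib]
  refine prod_le_prod (fun k _ => ?_) fun k _ => ?_ <;> split_ifs <;> nlinarith

theorem exp_inv_le_one_add_mul_one_sub_sq_pow {m : ℕ} (hm : 0 < m) :
    Real.exp (1 / (16 * m)) ≤ (1 + 1 / (2 * m)) * (1 - (1 / (2 * m)) ^ 2) ^ m := by
  set y : ℝ := 1 / m with hy
  have hy0 : 0 < y := by positivity
  have hy1 : y ≤ 1 := div_le_one_of_le₀ (by exact_mod_cast hm) m.cast_nonneg
  have hmy : m * y = 1 := mul_one_div_cancel (by positivity)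
  have hhalf : 1 / (2 * (m : ℝ)) = y / 2 := by rw [hy]; ring
  have hbernoulli : 1 - y / 4 ≤ (1 - (y / 2) ^ 2) ^ m := by
    have h := one_add_mul_le_pow (a := -(y / 2) ^ 2) (by nlinarith) m
    linear_combination h + y / 4 * hmy
  calc Real.exp (1 / (16 * m)) ≤ 1 + y / 8 := by
        rw [← Real.le_log_iff_exp_le (by positivity)]
        refine le_trans ?_ (Real.le_log_one_add_of_nonneg (by positivity))
        rw [show 1 / (16 * (m : ℝ)) = y / 16 by rw [hy]; ring, le_div_iff₀ (by positivity)]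
        nlinarith
    _ ≤ (1 + y / 2) * (1 - y / 4) := by nlinarith
    _ ≤ (1 + 1 / (2 * m)) * (1 - (1 / (2 * m)) ^ 2) ^ m := by
        rw [hhalf]
        gcongr

variable {τ : ι → Equiv.Perm Ω} {U V : Ω → Finset ι}

theorem card_unbalanced_mul_le_card [Finite ι]
    (hUV : ∀ k ω, k ∈ U (τ k ω) ↔ k ∈ V ω) (hVU : ∀ k ω, k ∈ V (τ k ω) ↔ k ∈ U ω)
    (hU : ∀ k l, l ≠ k → ∀ ω, l ∈ U (τ k ω) ↔ l ∈ U ω)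
    (hV : ∀ k l, l ≠ k → ∀ ω, l ∈ V (τ k ω) ↔ l ∈ V ω)
    {x : ℝ} (hx0 : 0 ≤ x) (hx1 : x ≤ 1) (u g : ℕ) :
    #{ω | #(U ω) ≤ u ∧ u + g ≤ #(V ω)} * ((1 + x) ^ g * (1 - x ^ 2) ^ u) ≤ Fintype.card Ω := by
  classical
  cases nonempty_fintype ι
  let d (k : ι) (ω : Ω) : ℝ := x * ((if k ∈ V ω then 1 else 0) - (if k ∈ U ω then 1 else 0))
  have hweight (ω : Ω) : (1 + x) ^ #(V ω) * (1 - x) ^ #(U ω) ≤ ∏ k, (1 + d k ω) :=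
    one_add_pow_card_mul_one_sub_pow_card_le_prod hx0 hx1 _ _
  have hx1' : 0 ≤ 1 - x := sub_nonneg.2 hx1
  have hsum : ∑ ω, ∏ k, (1 + d k ω) = (Fintype.card Ω : ℝ) :=
    sum_prod_one_add_eq_card (τ := τ) (fun k ω => by simp only [d, hUV, hVU]; ring)
      (fun k l hl ω => by simp only [d, hU k l hl, hV k l hl]) univ
  rw [← hsum, ← nsmul_eq_mul]
  refine (card_nsmul_le_sum _ _ _ fun ω hω => ?_).trans
    (sum_le_sum_of_subset_of_nonneg (filter_subset _ _) fun ω _ _ =>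
      (by positivity : 0 ≤ (1 + x) ^ #(V ω) * (1 - x) ^ #(U ω)).trans (hweight ω))
  obtain ⟨hUω, hVω⟩ := (mem_filter_univ _).1 hω
  calc (1 + x) ^ g * (1 - x ^ 2) ^ u = (1 + x) ^ (u + g) * (1 - x) ^ u := by
        rw [show 1 - x ^ 2 = (1 + x) * (1 - x) by ring, mul_pow, pow_add]
        ring
    _ ≤ (1 + x) ^ #(V ω) * (1 - x) ^ #(U ω) :=
        mul_le_mul (pow_le_pow_right₀ (by linarith) hVω)
          (pow_le_pow_of_le_one hx1' (by linarith) hUω) (by positivity) (by positivity)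
    _ ≤ ∏ k, (1 + d k ω) := hweight ω

theorem card_unbalanced_le_exp_mul_card [Finite ι]
    (hUV : ∀ k ω, k ∈ U (τ k ω) ↔ k ∈ V ω) (hVU : ∀ k ω, k ∈ V (τ k ω) ↔ k ∈ U ω)
    (hU : ∀ k l, l ≠ k → ∀ ω, l ∈ U (τ k ω) ↔ l ∈ U ω)
    (hV : ∀ k l, l ≠ k → ∀ ω, l ∈ V (τ k ω) ↔ l ∈ V ω)
    {m u g : ℕ} (hm : 0 < m) (hu : u ≤ m * g) :
    (#{ω | #(U ω) ≤ u ∧ u + g ≤ #(V ω)} : ℝ) ≤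
      Real.exp (-(g / (16 * m))) * Fintype.card Ω := by
  have hm1 : (1 : ℝ) ≤ m := by exact_mod_cast hm
  have hx0 : (0 : ℝ) ≤ 1 / (2 * m) := by positivity
  have hx1 : 1 / (2 * (m : ℝ)) ≤ 1 := div_le_one_of_le₀ (by linarith) (by positivity)
  have hx2 : 0 ≤ 1 - (1 / (2 * (m : ℝ))) ^ 2 := by nlinarith
  have hgain : Real.exp (g / (16 * m)) ≤
      (1 + 1 / (2 * m)) ^ g * (1 - (1 / (2 * m)) ^ 2) ^ u :=
    calc Real.exp (g / (16 * m)) = Real.exp (1 / (16 * m)) ^ g := by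
          rw [← Real.exp_nat_mul, mul_one_div]
      _ ≤ ((1 + 1 / (2 * m)) * (1 - (1 / (2 * m)) ^ 2) ^ m) ^ g := by
          gcongr
          exact exp_inv_le_one_add_mul_one_sub_sq_pow hm
      _ = (1 + 1 / (2 * m)) ^ g * (1 - (1 / (2 * m)) ^ 2) ^ (m * g) := by
          rw [mul_pow, ← pow_mul]
      _ ≤ (1 + 1 / (2 * m)) ^ g * (1 - (1 / (2 * m)) ^ 2) ^ u :=
          mul_le_mul_of_nonneg_left
            (pow_le_pow_of_le_one hx2 (sub_le_self _ (sq_nonneg _)) hu) (by positivity)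
  rw [Real.exp_neg, inv_mul_eq_div, le_div_iff₀ (Real.exp_pos _)]
  exact (mul_le_mul_of_nonneg_left hgain (Nat.cast_nonneg _)).trans
    (card_unbalanced_mul_le_card hUV hVU hU hV hx0 hx1 u g)

end Exchange

section HiddenPermutation

variable {V : Type*} [DecidableEq V]

theorem card_filter_symm_mem {ι : Type*} [Fintype ι] (S P : Finset V) (σ : Equiv.Perm V)
    (e : ι ≃ P) : #{k | σ.symm (e k) ∈ S} = #{a ∈ S | σ a ∈ P} := by
  refine card_bij (fun k _ => σ.symm (e k)) (fun k hk => ?_) (fun k _ l _ hkl => ?_)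
    fun a ha => ?_
  · rw [mem_filter_univ] at hk
    simp [hk]
  · exact e.injective (Subtype.ext (σ.symm.injective hkl))
  · obtain ⟨haS, haP⟩ := mem_filter.1 ha
    exact ⟨e.symm ⟨σ a, haP⟩, by simp [haS], by simp⟩

theorem card_perm_unbalanced_le [Fintype V] {P Q : Finset V} (hPQ : Disjoint P Q)
    (hcard : #P = #Q) {S : Equiv.Perm V → Finset V}
    (hS : ∀ σ, ∀ x ∈ P, ∀ y ∈ Q, S (Equiv.swap x y * σ) = S σ) {m u g : ℕ} (hm : 0 < m)
    (hu : u ≤ m * g) :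
    (#{σ : Equiv.Perm V | #{a ∈ S σ | σ a ∈ P} ≤ u ∧ u + g ≤ #{a ∈ S σ | σ a ∈ Q}} : ℝ) ≤
      Real.exp (-(g / (16 * m))) * (Fintype.card V).factorial := by
  let e : P ≃ Q := equivOfCardEq hcard
  let τ (k : P) : Equiv.Perm (Equiv.Perm V) := Equiv.mulLeft (Equiv.swap (k : V) (e k))
  let A (σ : Equiv.Perm V) : Finset P := {k | σ.symm k ∈ S σ}
  let B (σ : Equiv.Perm V) : Finset P := {k | σ.symm (e k) ∈ S σ}
  have hne (k l : P) : (k : V) ≠ e l := fun h => disjoint_left.1 hPQ k.2 (h ▸ (e l).2)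
  have hτ (k : P) (σ : Equiv.Perm V) (v : V) :
      (τ k σ).symm v ∈ S (τ k σ) ↔ σ.symm (Equiv.swap (k : V) (e k) v) ∈ S σ := by
    rw [show τ k σ = Equiv.swap (k : V) (e k) * σ from rfl, hS σ k k.2 _ (e k).2]
    rfl
  have hA (σ : Equiv.Perm V) : #(A σ) = #{a ∈ S σ | σ a ∈ P} :=
    card_filter_symm_mem (S σ) P σ (Equiv.refl P)
  have hB (σ : Equiv.Perm V) : #(B σ) = #{a ∈ S σ | σ a ∈ Q} := card_filter_symm_mem (S σ) Q σ e
  simp only [← hA, ← hB, ← Fintype.card_perm]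
  exact card_unbalanced_le_exp_mul_card (τ := τ)
    (fun k σ => by simp [A, B, hτ]) (fun k σ => by simp [A, B, hτ])
    (fun k l hl σ => by
      simp [A, hτ, Equiv.swap_apply_of_ne_of_ne (Subtype.coe_ne_coe.2 hl) (hne l k)])
    (fun k l hl σ => by
      simp [B, hτ, Equiv.swap_apply_of_ne_of_ne (hne k l).symm
        (Subtype.coe_ne_coe.2 (e.injective.ne hl))])
    hm hu

end HiddenPermutation

namespace QueryAlgorithm

variable {n r q : ℕ}

/-- The answers that the algorithm receives in its first `i` steps when step `t` is answered by
its own oracle `O t`; the hybrid runs of the lower bound replace the true oracle by one that knows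
less in earlier steps. -/
def hybridAnswers (D : QueryAlgorithm n r q) (O : ℕ → Finset (Fin n) → Bool) :
    (i : ℕ) → i ≤ r → Fin i → Fin q → Bool
  | 0, _ => fun j => j.elim0
  | i + 1, h =>
      Fin.snoc (α := fun _ => Fin q → Bool) (hybridAnswers D O i (Nat.le_of_succ_le h))
        (fun k => O i (D.query ⟨i, h⟩ (hybridAnswers D O i (Nat.le_of_succ_le h)) k))

/-- The `k`-th query of step `t` when each step is answered by its own oracle. -/
def hybridQuery (D : QueryAlgorithm n r q) (O : ℕ → Finset (Fin n) → Bool) (t : Fin r)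
    (k : Fin q) : Finset (Fin n) :=
  D.query t (D.hybridAnswers O t t.2.le) k

/-- The output of the algorithm when each step is answered by its own oracle. -/
def hybridRun (D : QueryAlgorithm n r q) (O : ℕ → Finset (Fin n) → Bool) : Finset (Fin n) :=
  D.output (D.hybridAnswers O r le_rfl)

theorem hybridAnswers_congr (D : QueryAlgorithm n r q) {O O' : ℕ → Finset (Fin n) → Bool} :
    ∀ (i : ℕ) (hi : i ≤ r), (∀ t < i, O t = O' t) →
      D.hybridAnswers O i hi = D.hybridAnswers O' i hi
  | 0, _, _ => rfl
  | i + 1, hi, hO => by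
    have ih := hybridAnswers_congr D i (Nat.le_of_succ_le hi) fun t ht =>
      hO t (Nat.lt_succ_of_lt ht)
    simp only [hybridAnswers, hO i i.lt_succ_self, ih]

theorem hybridQuery_congr (D : QueryAlgorithm n r q) {O O' : ℕ → Finset (Fin n) → Bool}
    {t : Fin r} (hO : ∀ i < (t : ℕ), O i = O' i) (k : Fin q) :
    D.hybridQuery O t k = D.hybridQuery O' t k := by
  rw [hybridQuery, hybridQuery, D.hybridAnswers_congr t t.2.le hO]

theorem hybridRun_congr (D : QueryAlgorithm n r q) {O O' : ℕ → Finset (Fin n) → Bool}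
    (hO : ∀ i < r, O i = O' i) : D.hybridRun O = D.hybridRun O' := by
  rw [hybridRun, hybridRun, D.hybridAnswers_congr r le_rfl hO]

theorem answers_eq_hybridAnswers (D : QueryAlgorithm n r q) {O : Finset (Fin n) → Bool}
    {O' : ℕ → Finset (Fin n) → Bool}
    (h : ∀ (t : Fin r) k, O (D.hybridQuery O' t k) = O' t (D.hybridQuery O' t k)) :
    ∀ (i : ℕ) (hi : i ≤ r), D.answers O i hi = D.hybridAnswers O' i hi
  | 0, _ => rfl
  | i + 1, hi => by
    have hstep (k : Fin q) := h ⟨i, hi⟩ k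
    simp only [hybridQuery] at hstep
    simp only [answers, hybridAnswers, D.answers_eq_hybridAnswers h i, hstep]

theorem run_eq_hybridRun (D : QueryAlgorithm n r q) {O : Finset (Fin n) → Bool}
    {O' : ℕ → Finset (Fin n) → Bool}
    (h : ∀ (t : Fin r) k, O (D.hybridQuery O' t k) = O' t (D.hybridQuery O' t k)) :
    D.run O = D.hybridRun O' := by
  rw [run, hybridRun, D.answers_eq_hybridAnswers h]

/-- The deterministic algorithm `D`, run with the independence oracle of `M`, returns an
`α`-approximation of the maximum size of an independent set. -/
def Succeeds (D : QueryAlgorithm n r q) (M : Matroid (Fin n)) (α : ℝ) : Prop :=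
  IsApproxSolution M (fun S => (#S : ℝ)) α (D.run (indepOracle M))

end QueryAlgorithm

namespace RandomizedAlgorithm

variable {n r q m : ℕ}

open Classical in
theorem hiddenSuccessProb_le_of_forall_card_succeeds_le (A : RandomizedAlgorithm n r q)
    {part : Fin n → Fin m} {cap : Fin m → ℕ} {α p : ℝ}
    (h : ∀ D : QueryAlgorithm n r q,
      (#{σ : Equiv.Perm (Fin n) | D.Succeeds (partitionMatroid (part ∘ σ) cap) α} : ℝ) ≤
        p * n.factorial) :
    A.hiddenSuccessProb part cap α ≤ p := by
  have hfac : (0 : ℝ) < n.factorial := by exact_mod_cast n.factorial_pos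
  have hbound : 0 ≤ p * n.factorial :=
    (Nat.cast_nonneg _).trans (h A.support_nonempty.some)
  have hfinite (s : Set (QueryAlgorithm n r q)) : A.toOuterMeasure s ≠ ⊤ :=
    ne_top_of_le_ne_top ENNReal.one_ne_top <| by
      rw [← A.tsum_coe, PMF.toOuterMeasure_apply]
      exact ENNReal.tsum_le_tsum fun D => Set.indicator_le_self _ _ D
  simp only [hiddenSuccessProb, successProb]
  rw [div_le_iff₀ hfac, ← ENNReal.toReal_sum fun σ _ => hfinite _]
  refine ENNReal.toReal_le_of_le_ofReal hbound ?_
  simp only [PMF.toOuterMeasure_apply]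
  rw [← Summable.tsum_finsetSum fun _ _ => ENNReal.summable]
  calc ∑' D, ∑ σ : Equiv.Perm (Fin n), Set.indicator
          {D | D.Succeeds (partitionMatroid (part ∘ σ) cap) α} A D
      = ∑' D, A D * #{σ : Equiv.Perm (Fin n) |
          D.Succeeds (partitionMatroid (part ∘ σ) cap) α} := by
        simp only [Set.indicator_apply, Set.mem_ofPred_eq, ← sum_filter, sum_const, nsmul_eq_mul,
          mul_comm]
    _ ≤ ∑' D, A D * ENNReal.ofReal (p * n.factorial) := by
        gcongr with D
        rw [← ENNReal.ofReal_natCast]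
        exact ENNReal.ofReal_le_ofReal (h D)
    _ = ENNReal.ofReal (p * n.factorial) := by rw [ENNReal.tsum_mul_right, A.tsum_coe, one_mul]

theorem exists_successProb_le_hiddenSuccessProb (A : RandomizedAlgorithm n r q)
    (part : Fin n → Fin m) (cap : Fin m → ℕ) (α : ℝ) :
    ∃ σ : Equiv.Perm (Fin n),
      A.successProb (partitionMatroid (part ∘ σ) cap) α ≤ A.hiddenSuccessProb part cap α := by
  have hfac : (n.factorial : ℝ) ≠ 0 := by exact_mod_cast n.factorial_ne_zero
  have hsum : ∑ σ : Equiv.Perm (Fin n), A.successProb (partitionMatroid (part ∘ σ) cap) α ≤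
      ∑ _σ : Equiv.Perm (Fin n), A.hiddenSuccessProb part cap α := by
    rw [sum_const, card_univ, Fintype.card_perm, Fintype.card_fin, nsmul_eq_mul,
      hiddenSuccessProb, mul_div_cancel₀ _ hfac]
  obtain ⟨σ, -, hσ⟩ := exists_le_of_sum_le univ_nonempty hsum
  exact ⟨σ, hσ⟩

end RandomizedAlgorithm

section Staircase

variable {n m : ℕ}

theorem exists_indep_partitionMatroid_card_eq_sum {part : Fin n → Fin m} {cap : Fin m → ℕ}
    (hcap : ∀ i, cap i ≤ #{a | part a = i}) :
    ∃ T : Finset (Fin n), (partitionMatroid part cap).Indep (T : Set (Fin n)) ∧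
      #T = ∑ i, cap i := by
  choose T hT hcard using fun i => exists_subset_card_eq (hcap i)
  have hpart {a : Fin n} {i : Fin m} (ha : a ∈ T i) : part a = i :=
    (mem_filter.1 (hT i ha)).2
  have hfiber (i : Fin m) : {a ∈ univ.biUnion T | part a = i} = T i := by
    ext a
    simp only [mem_filter, mem_biUnion, mem_univ, true_and]
    exact ⟨fun ⟨⟨j, hj⟩, hi⟩ => hi ▸ hpart hj ▸ hj, fun ha => ⟨⟨i, ha⟩, hpart ha⟩⟩
  refine ⟨univ.biUnion T, (partitionMatroid_indep_iff _ _ _).2 fun i => ?_, ?_⟩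
  · rw [hfiber, hcard]
  · rw [card_eq_sum_card_fiberwise (f := part) (t := univ) (by simp)]
    simp only [hfiber, hcard]

theorem one_le_of_isApproxSolution_card {M : Matroid (Fin n)} {α : ℝ} {S T : Finset (Fin n)}
    (hS : IsApproxSolution M (fun S => (#S : ℝ)) α S) (hT : M.Indep (T : Set (Fin n)))
    (hT0 : 0 < #T) : 1 ≤ α := by
  have hTS : (#T : ℝ) ≤ α * #S := hS.2 T hT
  have hSS : (#S : ℝ) ≤ α * #S := hS.2 S hS.1
  have hTpos : (0 : ℝ) < #T := by exact_mod_cast hT0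
  have hSpos : (0 : ℝ) < #S := by
    refine (Nat.cast_nonneg _).lt_of_ne' fun hS0 => ?_
    rw [hS0, mul_zero] at hTS
    exact hTpos.not_ge hTS
  exact le_of_mul_le_mul_right (by rwa [one_mul]) hSpos

/-- The partition matroid whose part `i` has capacity `i * g`. The hidden matroids of the lower
bound are of this form; part `0` absorbs the elements left over when the ground set is cut into
`m` parts of equal size. -/
abbrev staircaseMatroid (part : Fin n → Fin (m + 1)) (g : ℕ) : Matroid (Fin n) :=
  partitionMatroid part fun i => i * g

/-- The oracle that answers step `t` of the hybrid runs: it checks the capacities of the parts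
`0, …, t + 1` of the staircase matroid only, so that each step reveals one more part. -/
def stepOracle (part : Fin n → Fin (m + 1)) (g t : ℕ) (S : Finset (Fin n)) : Bool :=
  decide (∀ i : Fin (m + 1), (i : ℕ) ≤ t + 1 → #{a ∈ S | part a = i} ≤ i * g)

/-- The set `S` tells part `i` of a staircase matroid apart from a later part: it respects the
capacity `i * g` of part `i`, and has at least `(i + 1) * g` elements in some part beyond `i`. -/
def Separates (part : Fin n → Fin (m + 1)) (g : ℕ) (S : Finset (Fin n)) (i : Fin (m + 1)) : Prop :=
  ∃ j ∈ Ioi i, #{a ∈ S | part a = i} ≤ i * g ∧ i * g + g ≤ #{a ∈ S | part a = j}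

instance (part : Fin n → Fin (m + 1)) (g : ℕ) (S : Finset (Fin n)) (i : Fin (m + 1)) :
    Decidable (Separates part g S i) :=
  inferInstanceAs (Decidable (∃ j ∈ Ioi i, _))

theorem card_filter_lt_of_not_separates {part : Fin n → Fin (m + 1)} {g : ℕ} {S : Finset (Fin n)}
    {i j : Fin (m + 1)} (hS : ¬ Separates part g S i) (hi : #{a ∈ S | part a = i} ≤ i * g)
    (hij : i < j) : #{a ∈ S | part a = j} < i * g + g :=
  not_le.1 fun hj => hS ⟨j, mem_Ioi.2 hij, hi, hj⟩

theorem indepOracle_eq_stepOracle_of_not_separates {part : Fin n → Fin (m + 1)} {g t : ℕ}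
    {S : Finset (Fin n)} {i : Fin (m + 1)} (hi : (i : ℕ) = t + 1) (hS : ¬ Separates part g S i) :
    indepOracle (staircaseMatroid part g) S = stepOracle part g t S := by
  simp only [indepOracle, stepOracle, decide_eq_decide, partitionMatroid_indep_iff, ← hi]
  refine ⟨fun h j _ => h j, fun h j => ?_⟩
  rcases le_or_gt j i with hji | hij
  · exact h j hji
  · calc #{a ∈ S | part a = j} ≤ i * g + g :=
          (card_filter_lt_of_not_separates hS (h i le_rfl) hij).le
      _ = (i + 1) * g := (add_one_mul _ _).symm
      _ ≤ j * g := Nat.mul_le_mul_right g hij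

theorem card_le_of_not_separates {part : Fin n → Fin (m + 1)} {g : ℕ} {S : Finset (Fin n)}
    {i : Fin (m + 1)} (hS : ¬ Separates part g S i)
    (hindep : (staircaseMatroid part g).Indep (S : Set (Fin n))) : #S ≤ m * ((i + 1) * g) := by
  rw [partitionMatroid_indep_iff] at hindep
  have hzero : #{a ∈ S | part a = 0} = 0 := by simpa using hindep 0
  have hpart (j : Fin (m + 1)) : #{a ∈ S | part a = j} ≤ (i + 1) * g := by
    rcases le_or_gt j i with hji | hij
    · exact (hindep j).trans (Nat.mul_le_mul_right g (Nat.le_succ_of_le hji))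
    · exact (card_filter_lt_of_not_separates hS (hindep i) hij).le.trans_eq (add_one_mul _ _).symm
  rw [card_eq_sum_card_fiberwise (f := part) (t := univ) (by simp), Fin.sum_univ_succ, hzero,
    zero_add]
  exact (sum_le_card_nsmul _ _ _ fun j _ => hpart j.succ).trans (by simp)

theorem apply_swap_eq_iff_of_ne {V κ : Type*} [DecidableEq V] {f : V → κ} {x y : V} {c : κ}
    (hx : f x ≠ c) (hy : f y ≠ c) (v : V) : f (Equiv.swap x y v) = c ↔ f v = c := by
  rcases eq_or_ne v x with rfl | hvx
  · simp [hx, hy]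
  rcases eq_or_ne v y with rfl | hvy
  · simp [hx, hy]
  rw [Equiv.swap_apply_of_ne_of_ne hvx hvy]

theorem stepOracle_comp_swap_mul {part : Fin n → Fin (m + 1)} {t : ℕ} {x y : Fin n}
    (hx : t + 1 < part x) (hxy : part x < part y) (g : ℕ) (σ : Equiv.Perm (Fin n)) :
    stepOracle (part ∘ (Equiv.swap x y * σ)) g t = stepOracle (part ∘ σ) g t := by
  funext S
  simp only [stepOracle, decide_eq_decide]
  refine forall₂_congr fun i hi => ?_
  have hix : i < part x := hi.trans_lt hx
  simp only [Function.comp_apply, Equiv.Perm.mul_apply,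
    apply_swap_eq_iff_of_ne hix.ne' (hix.trans hxy).ne']

theorem card_filter_comp_perm_eq (part : Fin n → Fin m) (σ : Equiv.Perm (Fin n)) (i : Fin m) :
    #{a | (part ∘ σ) a = i} = #{a | part a = i} :=
  card_equiv σ (by simp)

theorem card_separates_le {part : Fin n → Fin (m + 1)} {s : ℕ}
    (hpart : ∀ i ≠ 0, #{a | part a = i} = s) (g : ℕ) {i : Fin (m + 1)} (hi : i ≠ 0)
    {S : Equiv.Perm (Fin n) → Finset (Fin n)}
    (hS : ∀ σ x y, part x = i → i < part y → S (Equiv.swap x y * σ) = S σ) :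
    (#{σ : Equiv.Perm (Fin n) | Separates (part ∘ σ) g (S σ) i} : ℝ) ≤
      m * (Real.exp (-(g / (16 * m))) * n.factorial) := by
  have hi0 : 0 < i := Fin.pos_iff_ne_zero.2 hi
  have hpair : ∀ j ∈ Ioi i, (#{σ : Equiv.Perm (Fin n) | #{a ∈ S σ | (part ∘ σ) a = i} ≤ i * g ∧
      i * g + g ≤ #{a ∈ S σ | (part ∘ σ) a = j}} : ℝ) ≤
        Real.exp (-(g / (16 * m))) * n.factorial := by
    intro j hj
    rw [mem_Ioi] at hj
    have hdisj : Disjoint (α := Finset (Fin n)) {a | part a = i} {a | part a = j} :=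
      disjoint_filter.2 fun a _ hai haj => hj.ne (hai.symm.trans haj)
    have hcard : #{a | part a = i} = #{a | part a = j} := by
      rw [hpart i hi, hpart j (hi0.trans hj).ne']
    have hbound := card_perm_unbalanced_le hdisj hcard (S := S) (m := m) (u := i * g) (g := g)
      (fun σ x hx y hy => hS σ x y (mem_filter.1 hx).2
        ((mem_filter.1 hy).2.symm ▸ hj))
      (by omega) (Nat.mul_le_mul_right g (by omega))
    simpa using hbound
  calc (#{σ : Equiv.Perm (Fin n) | Separates (part ∘ σ) g (S σ) i} : ℝ)
      ≤ #(Ioi i) * (Real.exp (-(g / (16 * m))) * n.factorial) := card_filter_exists_le _ _ hpair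
    _ ≤ m * (Real.exp (-(g / (16 * m))) * n.factorial) := by
        gcongr
        rw [Fin.card_Ioi]
        omega

theorem exists_indep_staircaseMatroid_two_mul_card_eq {part : Fin n → Fin (m + 1)} {s g : ℕ}
    (hpart : ∀ i ≠ 0, #{a | part a = i} = s) (hs : m * g ≤ s) :
    ∃ T : Finset (Fin n), (staircaseMatroid part g).Indep (T : Set (Fin n)) ∧
      2 * #T = m * (m + 1) * g := by
  have hcap (i : Fin (m + 1)) : i * g ≤ #{a | part a = i} := by
    rcases eq_or_ne i 0 with rfl | hi
    · simp
    · rw [hpart i hi]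
      exact (Nat.mul_le_mul_right g (by omega)).trans hs
  obtain ⟨T, hT, hcard⟩ := exists_indep_partitionMatroid_card_eq_sum hcap
  refine ⟨T, hT, ?_⟩
  rw [hcard, ← sum_mul, Fin.sum_univ_eq_sum_range (fun i => i), ← mul_assoc, mul_comm 2,
    sum_range_id_mul_two, Nat.add_sub_cancel, mul_comm (m + 1)]

theorem one_le_of_isApproxSolution_staircaseMatroid {part : Fin n → Fin (m + 1)} {s g : ℕ}
    (hpart : ∀ i ≠ 0, #{a | part a = i} = s) (hs : m * g ≤ s) (hmg : 0 < m * g) {α : ℝ}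
    {S : Finset (Fin n)}
    (hS : IsApproxSolution (staircaseMatroid part g) (fun S => (#S : ℝ)) α S) : 1 ≤ α := by
  obtain ⟨T, hT, hTcard⟩ := exists_indep_staircaseMatroid_two_mul_card_eq hpart hs
  have hTpos : 0 < 2 * #T := by
    rw [hTcard, mul_right_comm]
    exact Nat.mul_pos hmg m.succ_pos
  exact one_le_of_isApproxSolution_card hS hT (by omega)

theorem lt_card_of_isApproxSolution_staircaseMatroid {part : Fin n → Fin (m + 1)} {s g k : ℕ}
    (hpart : ∀ i ≠ 0, #{a | part a = i} = s) (hs : m * g ≤ s) (hmg : 0 < m * g) {α : ℝ}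
    (hα : 0 ≤ α) (hk : 2 * α * k < m + 1) {S : Finset (Fin n)}
    (hS : IsApproxSolution (staircaseMatroid part g) (fun S => (#S : ℝ)) α S) :
    m * (k * g) < #S := by
  obtain ⟨T, hT, hTcard⟩ := exists_indep_staircaseMatroid_two_mul_card_eq hpart hs
  have hTcard' : 2 * (#T : ℝ) = m * (m + 1) * g := by exact_mod_cast hTcard
  have hTS : (#T : ℝ) ≤ α * #S := hS.2 T hT
  have hmg' : (0 : ℝ) < m * g := by exact_mod_cast hmg
  by_contra! hle
  have hle' : (#S : ℝ) ≤ m * (k * g) := by exact_mod_cast hle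
  have : (m * g : ℝ) * (m + 1) ≤ m * g * (2 * α * k) :=
    calc (m * g : ℝ) * (m + 1) = 2 * #T := by rw [hTcard']; ring
      _ ≤ 2 * (α * #S) := by gcongr
      _ ≤ 2 * (α * (m * (k * g))) := by gcongr
      _ = m * g * (2 * α * k) := by ring
  exact hk.not_ge (le_of_mul_le_mul_left this hmg')

end Staircase

namespace QueryAlgorithm

variable {n m r q s g : ℕ} {part : Fin n → Fin (m + 1)} {α : ℝ}

theorem exists_separates_of_succeeds (D : QueryAlgorithm n r q) (hr : r < m)
    (hpart : ∀ i ≠ 0, #{a | part a = i} = s) (hs : m * g ≤ s) (hg : 0 < g)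
    (hα : 0 ≤ α) (hmr : 2 * α * (r + 2) < m + 1) (hD : D.Succeeds (staircaseMatroid part g) α) :
    (∃ p : Fin r × Fin q, Separates part g (D.hybridQuery (stepOracle part g) p.1 p.2)
        ⟨p.1 + 1, by omega⟩) ∨
      Separates part g (D.hybridRun (stepOracle part g)) ⟨r + 1, by omega⟩ := by
  by_contra! hsep
  obtain ⟨hqueries, hout⟩ := hsep
  have hrun : D.run (indepOracle (staircaseMatroid part g)) =
      D.hybridRun (stepOracle part g) :=
    D.run_eq_hybridRun fun t k => indepOracle_eq_stepOracle_of_not_separates rfl (hqueries (t, k))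
  rw [Succeeds, hrun] at hD
  have hlarge := lt_card_of_isApproxSolution_staircaseMatroid (k := r + 2) hpart hs
    (Nat.mul_pos (by omega) hg) hα (by exact_mod_cast hmr) hD
  exact hlarge.not_ge (card_le_of_not_separates hout hD.1)

open Classical in
theorem card_succeeds_staircaseMatroid_le (D : QueryAlgorithm n r q) (hr : r < m)
    (hpart : ∀ i ≠ 0, #{a | part a = i} = s) (hs : m * g ≤ s) (hg : 0 < g)
    (hα : 0 ≤ α) (hmr : 2 * α * (r + 2) < m + 1) :
    (#{σ : Equiv.Perm (Fin n) | D.Succeeds (staircaseMatroid (part ∘ σ) g) α} : ℝ) ≤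
      (r * q + 1) * (m * (Real.exp (-(g / (16 * m))) * n.factorial)) := by
  have hquery : ∀ p ∈ (univ : Finset (Fin r × Fin q)), (#{σ : Equiv.Perm (Fin n) |
      Separates (part ∘ σ) g (D.hybridQuery (stepOracle (part ∘ σ) g) p.1 p.2)
        ⟨p.1 + 1, by omega⟩} : ℝ) ≤ m * (Real.exp (-(g / (16 * m))) * n.factorial) := by
    refine fun p _ => card_separates_le hpart g (Fin.ne_of_gt p.1.1.succ_pos) fun σ x y hx hxy => ?_
    exact D.hybridQuery_congr (fun t ht => stepOracle_comp_swap_mul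
      (hx ▸ Nat.succ_lt_succ ht) (hx.trans_lt hxy) g σ) p.2
  have houtput : (#{σ : Equiv.Perm (Fin n) |
      Separates (part ∘ σ) g (D.hybridRun (stepOracle (part ∘ σ) g)) ⟨r + 1, by omega⟩} : ℝ) ≤
        m * (Real.exp (-(g / (16 * m))) * n.factorial) := by
    refine card_separates_le hpart g (Fin.ne_of_gt r.succ_pos) fun σ x y hx hxy => ?_
    exact D.hybridRun_congr fun t ht => stepOracle_comp_swap_mul
      (hx ▸ Nat.succ_lt_succ ht) (hx.trans_lt hxy) g σ
  have hcover : (univ.filter fun σ : Equiv.Perm (Fin n) =>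
        D.Succeeds (staircaseMatroid (part ∘ σ) g) α) ⊆
      (univ.filter fun σ : Equiv.Perm (Fin n) => ∃ p ∈ (univ : Finset (Fin r × Fin q)),
        Separates (part ∘ σ) g (D.hybridQuery (stepOracle (part ∘ σ) g) p.1 p.2)
          ⟨p.1 + 1, by omega⟩) ∪
      univ.filter fun σ : Equiv.Perm (Fin n) =>
        Separates (part ∘ σ) g (D.hybridRun (stepOracle (part ∘ σ) g)) ⟨r + 1, by omega⟩ := by
    intro σ hσ
    simp only [mem_union, mem_filter_univ, mem_univ, true_and] at hσ ⊢
    exact D.exists_separates_of_succeeds hr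
      (fun i hi => (card_filter_comp_perm_eq part σ i).trans (hpart i hi)) hs hg hα hmr hσ
  have hunion := (card_le_card hcover).trans (card_union_le _ _)
  calc (#{σ : Equiv.Perm (Fin n) | D.Succeeds (staircaseMatroid (part ∘ σ) g) α} : ℝ)
      ≤ _ + _ := by exact_mod_cast hunion
    _ ≤ #(univ : Finset (Fin r × Fin q)) * (m * (Real.exp (-(g / (16 * m))) * n.factorial)) +
          m * (Real.exp (-(g / (16 * m))) * n.factorial) :=
        add_le_add (card_filter_exists_le _ _ hquery) houtput
    _ = (r * q + 1) * (m * (Real.exp (-(g / (16 * m))) * n.factorial)) := by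
        simp only [card_univ, Fintype.card_prod, Fintype.card_fin, Nat.cast_mul]
        ring

end QueryAlgorithm

section Parameters

/-- The map to parts that cuts off `m` consecutive blocks of `s` elements. The blocks are the parts
`1, …, m`, and the remaining elements form part `0`. -/
def blockPart (n m s : ℕ) (a : Fin n) : Fin (m + 1) :=
  if h : (a : ℕ) < m * s then (finProdFinEquiv.symm ⟨a, h⟩).1.succ else 0

theorem card_filter_blockPart_eq {n m s : ℕ} (h : m * s ≤ n) {i : Fin (m + 1)} (hi : i ≠ 0) :
    #{a | blockPart n m s a = i} = s := by
  obtain ⟨j, rfl⟩ := Fin.exists_succ_eq.2 hi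
  have hcard : #(univ : Finset (Fin s)) = #{a | blockPart n m s a = j.succ} := by
    refine card_bij (fun k _ => Fin.castLE h (finProdFinEquiv (j, k))) (fun k _ => ?_)
      (fun k _ l _ hkl => ?_) fun a ha => ?_
    · refine mem_filter.2 ⟨mem_univ _, ?_⟩
      simp only [blockPart, Fin.val_castLE, Fin.is_lt, dite_true, Fin.eta, Equiv.symm_apply_apply]
    · exact (Prod.mk.inj (finProdFinEquiv.injective (Fin.castLE_injective h hkl))).2
    · have hj := (mem_filter.1 ha).2
      rw [blockPart] at hj
      split_ifs at hj with hlt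
      · refine ⟨(finProdFinEquiv.symm ⟨a, hlt⟩).2, mem_univ _, ?_⟩
        rw [← Fin.succ_injective _ hj, Prod.mk.eta, Equiv.apply_symm_apply]
        rfl
      · exact absurd hj.symm (Fin.succ_ne_zero j)
  rw [← hcard, card_univ, Fintype.card_fin]

/-- The number of parts of positive capacity in the hidden matroid on `Fin n`. -/
noncomputable def numParts (n : ℕ) : ℕ :=
  ⌊(n : ℝ) ^ (1 / 3 : ℝ) / Real.log n ^ 2⌋₊

/-- The difference between the capacities of consecutive parts of the hidden matroid on `Fin n`.
It exceeds `numParts n` by the factor `log n ^ 2` that makes an unbalanced set as unlikely as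
`n ^ (-Ω(log n))`. -/
noncomputable def capGap (n : ℕ) : ℕ :=
  numParts n * ⌈Real.log n ^ 2⌉₊

/-- The map to parts of the hidden matroid on `Fin n` before relabelling. The parts other than part
`0` have as many elements as the largest capacity `numParts n * capGap n`. -/
noncomputable def hiddenPart (n : ℕ) : Fin n → Fin (numParts n + 1) :=
  blockPart n (numParts n) (numParts n * capGap n)

theorem eventually_le_rpow_div_log_sq (K : ℝ) :
    ∀ᶠ n : ℕ in Filter.atTop, K ≤ (n : ℝ) ^ (1 / 3 : ℝ) / Real.log n ^ 2 := by
  have hlittle := (isLittleO_log_rpow_rpow_atTop (2 : ℝ) (show (0 : ℝ) < 1 / 3 by norm_num)).bound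
    (show (0 : ℝ) < (|K| + 1)⁻¹ by positivity)
  filter_upwards [tendsto_natCast_atTop_atTop.eventually hlittle, Filter.eventually_ge_atTop 2]
    with n hn hn2
  have hlog : 0 < Real.log n := Real.log_pos (by exact_mod_cast hn2)
  rw [Real.rpow_two, Real.norm_of_nonneg (by positivity), Real.norm_of_nonneg (by positivity),
    le_inv_mul_iff₀ (by positivity)] at hn
  rw [le_div_iff₀ (by positivity)]
  calc K * Real.log n ^ 2 ≤ (|K| + 1) * Real.log n ^ 2 := by
        gcongr
        linarith [le_abs_self K]
    _ ≤ (n : ℝ) ^ (1 / 3 : ℝ) := hn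

theorem numParts_mul_partSize_le {n : ℕ} (hlog : 2 ≤ Real.log n) :
    numParts n * (numParts n * capGap n) ≤ n := by
  have hcube : ((n : ℝ) ^ (1 / 3 : ℝ)) ^ 3 = n := by
    rw [← Real.rpow_natCast, ← Real.rpow_mul (Nat.cast_nonneg _)]
    norm_num
  set y : ℝ := (n : ℝ) ^ (1 / 3 : ℝ)
  set l := Real.log n
  have hm : (numParts n : ℝ) ≤ y / l ^ 2 := Nat.floor_le (by positivity)
  have hceil : (⌈l ^ 2⌉₊ : ℝ) ≤ 2 * l ^ 2 := by
    have := Nat.ceil_lt_add_one (sq_nonneg l)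
    nlinarith
  have hreal : ((numParts n * (numParts n * capGap n) : ℕ) : ℝ) ≤ n :=
    calc ((numParts n * (numParts n * capGap n) : ℕ) : ℝ)
        = (numParts n : ℝ) ^ 3 * ⌈l ^ 2⌉₊ := by
          rw [capGap]
          push_cast
          ring
      _ ≤ (y / l ^ 2) ^ 3 * (2 * l ^ 2) := by gcongr
      _ = y ^ 3 * (2 / l ^ 4) := by field_simp
      _ ≤ y ^ 3 * 1 := by
          gcongr
          rw [div_le_one (by positivity)]
          calc (2 : ℝ) ≤ 2 ^ 4 := by norm_num
            _ ≤ l ^ 4 := by gcongr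
      _ = n := by rw [mul_one, hcube]
  exact_mod_cast hreal

theorem log_sq_div_le_capGap_div {n : ℕ} (hm : 0 < numParts n) :
    Real.log n ^ 2 / 16 ≤ capGap n / (16 * numParts n) := by
  have hm' : (numParts n : ℝ) ≠ 0 := by exact_mod_cast hm.ne'
  rw [capGap, Nat.cast_mul, mul_comm (16 : ℝ), mul_div_mul_left _ _ hm']
  gcongr
  exact Nat.le_ceil _

theorem two_mul_mul_add_two_lt_numParts_add_one {n r : ℕ} {α : ℝ} (hα : 0 < α)
    (hαn : 4 * α ≤ (n : ℝ) ^ (1 / 3 : ℝ) / Real.log n ^ 2)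
    (hr : (r : ℝ) ≤ (n : ℝ) ^ (1 / 3 : ℝ) / (4 * α * Real.log n ^ 2) - 1) :
    2 * α * (r + 2) < numParts n + 1 := by
  have hfloor : (n : ℝ) ^ (1 / 3 : ℝ) / Real.log n ^ 2 < numParts n + 1 := Nat.lt_floor_add_one _
  rw [le_sub_iff_add_le, mul_comm (4 * α), ← div_div, le_div_iff₀ (by positivity)] at hr
  linarith

theorem mul_add_one_mul_le_pow {n r q m C : ℕ} (hn : 2 ≤ n) (hr : r ≤ n) (hm : m ≤ n)
    (hq : q ≤ n ^ C) : (r * q + 1) * m ≤ n ^ (C + 3) :=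
  calc (r * q + 1) * m ≤ (n * n ^ C + n * n ^ C) * n := by
        gcongr
        exact Nat.mul_pos (by omega) (Nat.pow_pos (by omega))
    _ = 2 * n ^ (C + 2) := by ring
    _ ≤ n * n ^ (C + 2) := by gcongr
    _ = n ^ (C + 3) := by ring

theorem pow_mul_exp_neg_le_rpow {n k : ℕ} {x : ℝ} (hn : 0 < n) (hk : 32 * (k : ℝ) ≤ Real.log n)
    (hx : Real.log n ^ 2 / 16 ≤ x) :
    (n : ℝ) ^ k * Real.exp (-x) ≤ (n : ℝ) ^ (-(1 / 32 * Real.log n)) := by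
  have hn' : (0 : ℝ) < n := by exact_mod_cast hn
  have hlog : 0 ≤ Real.log n := Real.log_natCast_nonneg n
  calc (n : ℝ) ^ k * Real.exp (-x)
      = Real.exp (k * Real.log n - x) := by
        rw [Real.exp_sub, Real.exp_nat_mul, Real.exp_log hn', Real.exp_neg, div_eq_mul_inv]
    _ ≤ Real.exp (Real.log n * -(1 / 32 * Real.log n)) := by
        refine Real.exp_le_exp.2 ?_
        linarith [mul_le_mul_of_nonneg_right hk hlog]
    _ = (n : ℝ) ^ (-(1 / 32 * Real.log n)) := (Real.rpow_def_of_pos hn' _).symm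

end Parameters

open Classical in
theorem QueryAlgorithm.card_succeeds_hiddenPart_le {n r q C : ℕ} {α : ℝ}
    (D : QueryAlgorithm n r q) (hlog : 32 * ((C : ℝ) + 3) ≤ Real.log n)
    (hn : max 1 (4 * α) ≤ (n : ℝ) ^ (1 / 3 : ℝ) / Real.log n ^ 2)
    (hr : (r : ℝ) ≤ (n : ℝ) ^ (1 / 3 : ℝ) / (4 * α * Real.log n ^ 2) - 1) (hq : q ≤ n ^ C) :
    (#{σ : Equiv.Perm (Fin n) |
        D.Succeeds (staircaseMatroid (hiddenPart n ∘ σ) (capGap n)) α} : ℝ) ≤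
      (n : ℝ) ^ (-(1 / 32 * Real.log n)) * n.factorial := by
  have hlog2 : 2 ≤ Real.log n := by linarith [C.cast_nonneg (α := ℝ)]
  have hn2 : 2 ≤ n := by
    by_contra! hlt
    interval_cases n <;> norm_num at hlog2
  have hsize := numParts_mul_partSize_le hlog2
  have hpart (i : Fin (numParts n + 1)) (hi : i ≠ 0) :
      #{a | hiddenPart n a = i} = numParts n * capGap n := card_filter_blockPart_eq hsize hi
  have hm : 0 < numParts n := Nat.le_floor (by simpa using (le_max_left _ _).trans hn)
  have hg : 0 < capGap n := Nat.mul_pos hm (Nat.ceil_pos.2 (by positivity))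
  rcases eq_empty_or_nonempty {σ : Equiv.Perm (Fin n) |
      D.Succeeds (staircaseMatroid (hiddenPart n ∘ σ) (capGap n)) α} with hempty | ⟨σ, hσ⟩
  · rw [hempty]
    simp only [card_empty, Nat.cast_zero]
    positivity
  have hα : 1 ≤ α := one_le_of_isApproxSolution_staircaseMatroid
    (fun i hi => (card_filter_comp_perm_eq _ σ i).trans (hpart i hi)) le_rfl (Nat.mul_pos hm hg)
    (mem_filter.1 hσ).2
  have hmr := two_mul_mul_add_two_lt_numParts_add_one (by linarith) ((le_max_right _ _).trans hn) hr
  have hrm : r < numParts n := by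
    have : 1 * ((r : ℝ) + 2) ≤ α * (r + 2) := by gcongr
    exact_mod_cast (by linarith : (r : ℝ) < numParts n)
  have hmn : numParts n ≤ n := (Nat.le_mul_of_pos_right _ (Nat.mul_pos hm hg)).trans hsize
  have hpoly : ((r : ℝ) * q + 1) * numParts n ≤ (n : ℝ) ^ (C + 3) := by
    exact_mod_cast mul_add_one_mul_le_pow hn2 (hrm.le.trans hmn) hmn hq
  calc _ ≤ ((r : ℝ) * q + 1) * (numParts n *
          (Real.exp (-(capGap n / (16 * numParts n))) * n.factorial)) :=
        D.card_succeeds_staircaseMatroid_le hrm hpart le_rfl hg (by linarith) hmr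
    _ = ((r : ℝ) * q + 1) * numParts n * Real.exp (-(capGap n / (16 * numParts n))) *
          n.factorial := by ring
    _ ≤ (n : ℝ) ^ (C + 3) * Real.exp (-(capGap n / (16 * numParts n))) * n.factorial := by gcongr
    _ ≤ _ := by
        gcongr
        exact pow_mul_exp_neg_le_rpow (by omega) (by exact_mod_cast hlog)
          (log_sq_div_le_capGap_div hm)

theorem mainTheorem7 :
    ∃ c : ℝ, 0 < c ∧
      ∃ (m : ℕ → ℕ) (part : (n : ℕ) → Fin n → Fin (m n)) (cap : (n : ℕ) → Fin (m n) → ℕ),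
        ∀ α : ℝ, 0 < α → ∀ C : ℕ, ∃ n₀ : ℕ, ∀ n : ℕ, n₀ ≤ n →
          ∀ r q : ℕ,
            (r : ℝ) ≤ (n : ℝ) ^ (1 / 3 : ℝ) / (4 * α * Real.log (n : ℝ) ^ 2) - 1 →
            q ≤ n ^ C →
            ∀ A : RandomizedAlgorithm n r q,
              A.hiddenSuccessProb (part n) (cap n) α ≤ (n : ℝ) ^ (-(c * Real.log (n : ℝ))) ∧
              ∃ σ : Equiv.Perm (Fin n),
                A.successProb (partitionMatroid (part n ∘ σ) (cap n)) α ≤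
                  (n : ℝ) ^ (-(c * Real.log (n : ℝ))) := by
  refine ⟨1 / 32, by norm_num, fun n => numParts n + 1, hiddenPart, fun n i => i * capGap n, ?_⟩
  intro α _ C
  have hlog := (Real.tendsto_log_atTop.comp tendsto_natCast_atTop_atTop).eventually_ge_atTop
    (32 * ((C : ℝ) + 3))
  obtain ⟨n₀, hn₀⟩ := Filter.eventually_atTop.1
    (hlog.and (eventually_le_rpow_div_log_sq (max 1 (4 * α))))
  refine ⟨n₀, fun n hn r q hr hq A => ?_⟩
  obtain ⟨hlogn, hsize⟩ := hn₀ n hn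
  have hhidden := A.hiddenSuccessProb_le_of_forall_card_succeeds_le
    fun D => D.card_succeeds_hiddenPart_le hlogn hsize hr hq
  obtain ⟨σ, hσ⟩ := A.exists_successProb_le_hiddenSuccessProb (hiddenPart n)
    (fun i => i * capGap n) α
  exact ⟨hhidden, σ, hσ.trans hhidden⟩
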